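/- Let $m\ge 2$ and $n\ge 1$ be integers and $\zeta_m=e^{2\pi\sqrt{-1}/m}$. A function $f:\mathbb{Z}_2^n\to\mathbb{Z}_m$ is called an $(m,n)$-generalized bent function ($(m,n)$-GBF) if $|F(y)|^2=2^n$ for all $y\in\mathbb{Z}_2^n$, where $F(y)=\sum_{x\in\mathbb{Z}_2^n}\zeta_m^{f(x)}(-1)^{y\cdot x}$ and $y\cdot x$ is the usual inner product. Let $n\ge 1$ be odd and $m=2\prod_{i=1}^s p_i^{\alpha_i}$, where $s\ge 1$, $p_1<p_2<\cdots<p_s$ are odd primes and all $\alpha_i$ are positive integers. (a) If $s=1$, then there is no $(m,n)$-GBF if one of the following conditions is satisfied: (i) $p_1>2^{n-2}$; (ii) $p_1$ is not a Mersenne prime (that is, not of the form $2^k-1$) and $p_1>2^{n-3}$; (iii) $p_1\equiv 3$ or $5\pmod 8$. (b) Suppose $s\ge 2$. If $r$ is the least integer in $\{0,1,\dots,s-1\}$ such that $p_{r+1}+p_1>2^n+2$ (assuming that such an integer exists), and there is no $\left(2\prod_{i=1}^r p_i^{\alpha_i},\,n\right)$-GBF, then there is no $(m,n)$-GBF. In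 particular, there is no $(m,n)$-GBF if $p_1>2^{n-2}$ and $p_1+p_2>2^n+2$. -/

import Mathlib

open scoped BigOperators

/-- The primitive complex `m`-th root of unity `exp (2πi / m)`. -/
noncomputable def zetaRoot (m : ℕ) : ℂ :=
  Complex.exp (2 * Real.pi * Complex.I / m)

/-- The transform `F(y) = ∑ x, ζ_m ^ f(x) * (-1) ^ (y ⬝ x)` of `f : (ℤ/2)^n → ℤ/m`, where the
exponents are the least nonnegative representatives of `f(x) ∈ ℤ/m` and `y ⬝ x ∈ ℤ/2`. -/
noncomputable def gbfTransform {m n : ℕ} (f : (Fin n → ZMod 2) → ZMod m)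
    (y : Fin n → ZMod 2) : ℂ :=
  ∑ x : Fin n → ZMod 2, zetaRoot m ^ (f x).val * (-1 : ℂ) ^ (dotProduct y x).val

/-- `f : (ℤ/2)^n → ℤ/m` is an `(m, n)`-generalized bent function. The notion is meant for
`m ≥ 2` and `n ≥ 1`. -/
def IsGBF {m n : ℕ} (f : (Fin n → ZMod 2) → ZMod m) : Prop :=
  ∀ y : Fin n → ZMod 2, ‖gbfTransform f y‖ ^ 2 = (2 : ℝ) ^ n

/-- There is an `(m, n)`-generalized bent function. -/
def ExistsGBF (m n : ℕ) : Prop :=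
  ∃ f : (Fin n → ZMod 2) → ZMod m, IsGBF f

/-! Put `g = ζ_m ^ f`. Since `|F|²` is the Walsh transform of the autocorrelation of `g`, being bent
means that for each `a ≠ 0` the sum of the `2^n` roots of unity `g x * conj (g (x + a))` vanishes.

One odd prime `p`: `g` is a sign times a root of unity of `p`-power order, and the latter becomes
`1` modulo the prime above `p`. This leaves a sign function whose integral Walsh values `W` satisfy
`W² ≡ 2^n` mod `p`, while Parseval makes `2^n` the mean of `W²`. As `n` is odd, `2` is a square mod
`p`, which gives (iii). For `n ≥ 3` one has `W = 2u`, and `u²` is congruent to `Q = 2^(n-2)`, with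
mean `Q`. If `p > Q`, no `u²` lies below `Q`, so all equal `Q`, which is not a square. If only `2p >
Q`, the value `Q - p` is also possible, and `false_of_sq_modEq_of_lt_two_mul` excludes it by
counting.

Several primes: by `sum_eq_zero_of_card_lt`, a vanishing sum of fewer than `p + q - 2` terms, with
`q` a lower bound for the other primes, still vanishes when the `p`-power parts of its terms are
replaced by `1`. Applied to the autocorrelations, this removes `p` from the order; the primes are
removed from the largest downwards. -/

/-! ### Walsh transform and autocorrelation. -/

/-- The nontrivial quadratic character of the additive group `ℤ/2`, with integer values. -/
def signChar (v : ZMod 2) : ℤ := (-1) ^ v.val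

lemma signChar_zero : signChar 0 = 1 := by decide

lemma signChar_add (a b : ZMod 2) : signChar (a + b) = signChar a * signChar b := by
  revert a b; decide

lemma signChar_mul_self (a : ZMod 2) : signChar a * signChar a = 1 := by
  revert a; decide

lemma signChar_eq_or (a : ZMod 2) : signChar a = 1 ∨ signChar a = -1 := by
  revert a; decide

lemma add_self_zmod_two {n : ℕ} (a : Fin n → ZMod 2) : a + a = 0 := by
  funext i
  exact CharTwo.add_self_eq_zero (a i)

/-- Orthogonality of the characters of `(ℤ/2)^n`. -/
lemma sum_signChar_dotProduct {n : ℕ} (a : Fin n → ZMod 2) :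
    ∑ y : Fin n → ZMod 2, signChar (dotProduct y a) = if a = 0 then 2 ^ n else 0 := by
  split_ifs with h
  · subst h
    simp [signChar_zero]
  · obtain ⟨i, hi⟩ := Function.ne_iff.mp h
    have hi1 : a i = 1 := by
      have : ∀ b : ZMod 2, b ≠ 0 → b = 1 := by decide
      exact this _ hi
    have key : ∑ y : Fin n → ZMod 2, signChar (dotProduct y a)
        = ∑ y : Fin n → ZMod 2, -signChar (dotProduct y a) := by
      rw [← Equiv.sum_comp (Equiv.addRight (Pi.single i (1 : ZMod 2)))]
      refine Finset.sum_congr rfl fun y _ => ?_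
      rw [Equiv.coe_addRight, add_dotProduct, signChar_add, single_dotProduct, one_mul, hi1]
      have : signChar 1 = -1 := by decide
      rw [this]; ring
    rw [Finset.sum_neg_distrib] at key
    omega

/-- The Walsh–Hadamard transform of a complex function on `(ℤ/2)^n`. -/
noncomputable def walsh {n : ℕ} (g : (Fin n → ZMod 2) → ℂ) (y : Fin n → ZMod 2) : ℂ :=
  ∑ x, g x * (signChar (dotProduct y x) : ℂ)

/-- The autocorrelation of a complex function on `(ℤ/2)^n`. -/
noncomputable def autocorr {n : ℕ} (g : (Fin n → ZMod 2) → ℂ) (a : Fin n → ZMod 2) : ℂ :=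
  ∑ x, g x * (starRingEnd ℂ) (g (x + a))

lemma walsh_mul_conj {n : ℕ} (g : (Fin n → ZMod 2) → ℂ) (y : Fin n → ZMod 2) :
    walsh g y * (starRingEnd ℂ) (walsh g y)
      = ∑ a, autocorr g a * (signChar (dotProduct y a) : ℂ) := by
  have h : ∑ a, autocorr g a * (signChar (dotProduct y a) : ℂ)
      = ∑ x, ∑ a, g x * (starRingEnd ℂ) (g (x + a)) * (signChar (dotProduct y a) : ℂ) := by
    simp only [autocorr, Finset.sum_mul]
    exact Finset.sum_comm
  rw [h, walsh, map_sum, Finset.sum_mul_sum]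
  refine Finset.sum_congr rfl fun x _ => ?_
  rw [← Equiv.sum_comp (Equiv.addLeft x)]
  refine Finset.sum_congr rfl fun a _ => ?_
  rw [Equiv.coe_addLeft, dotProduct_add, signChar_add, map_mul, map_intCast]
  have : (signChar (dotProduct y x) : ℂ) * signChar (dotProduct y x) = 1 := by
    exact_mod_cast signChar_mul_self _
  push_cast
  linear_combination (g x * (starRingEnd ℂ) (g (x + a)) * (signChar (dotProduct y a) : ℂ)) * this

lemma sum_walsh_mul_conj {n : ℕ} (g : (Fin n → ZMod 2) → ℂ) (a : Fin n → ZMod 2) :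
    ∑ y, walsh g y * (starRingEnd ℂ) (walsh g y) * (signChar (dotProduct y a) : ℂ)
      = 2 ^ n * autocorr g a := by
  simp only [walsh_mul_conj, Finset.sum_mul]
  rw [Finset.sum_comm]
  have h : ∀ b : Fin n → ZMod 2,
      ∑ y : Fin n → ZMod 2, autocorr g b * (signChar (dotProduct y b) : ℂ)
        * (signChar (dotProduct y a) : ℂ) = if b = a then 2 ^ n * autocorr g a else 0 := by
    intro b
    have h1 : ∀ y : Fin n → ZMod 2, autocorr g b * (signChar (dotProduct y b) : ℂ)
        * (signChar (dotProduct y a) : ℂ)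
        = autocorr g b * ((signChar (dotProduct y (b + a)) : ℤ) : ℂ) := by
      intro y
      rw [dotProduct_add, signChar_add]; push_cast; ring
    simp only [h1, ← Finset.mul_sum]
    rw [← Int.cast_sum, sum_signChar_dotProduct]
    have hba : b + a = 0 ↔ b = a := by
      constructor
      · intro h
        have := congrArg (· + a) h
        simpa [add_assoc, add_self_zmod_two] using this
      · rintro rfl; exact add_self_zmod_two b
    by_cases hb : b = a
    · subst hb
      simp [add_self_zmod_two, mul_comm]
    · simp [hba, hb]
  simp [h]

/-- A function on the group is supported at `0` exactly when its transform is constant; here the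
function is the autocorrelation, whose value at `0` is `2^n`. -/
lemma walsh_normSq_iff {n : ℕ} (g : (Fin n → ZMod 2) → ℂ) (hg : ∀ x, ‖g x‖ = 1) :
    (∀ y, ‖walsh g y‖ ^ 2 = (2 : ℝ) ^ n) ↔ ∀ a, a ≠ 0 → autocorr g a = 0 := by
  have hc : ∀ y, (‖walsh g y‖ ^ 2 = (2 : ℝ) ^ n) ↔
      walsh g y * (starRingEnd ℂ) (walsh g y) = 2 ^ n := by
    intro y
    rw [Complex.mul_conj, Complex.normSq_eq_norm_sq]
    norm_cast
  have h0 : autocorr g 0 = 2 ^ n := by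
    simp only [autocorr, add_zero, Complex.mul_conj, Complex.normSq_eq_norm_sq, hg]
    simp
  simp only [hc]
  constructor
  · intro h a ha
    have h1 := sum_walsh_mul_conj g a
    simp only [h, ← Finset.mul_sum] at h1
    rw [← Int.cast_sum, sum_signChar_dotProduct, if_neg ha] at h1
    simpa using h1.symm
  · intro h y
    rw [walsh_mul_conj, Finset.sum_eq_single 0]
    · simp [h0, signChar_zero]
    · intro a _ ha; simp [h a ha]
    · simp

lemma existsGBF_iff_walsh {m n : ℕ} (hm : 0 < m) :
    ExistsGBF m n ↔ ∃ g : (Fin n → ZMod 2) → ℂ, (∀ x, g x ^ m = 1) ∧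
      ∀ y, ‖walsh g y‖ ^ 2 = (2 : ℝ) ^ n := by
  have hz : IsPrimitiveRoot (zetaRoot m) m := Complex.isPrimitiveRoot_exp m hm.ne'
  have hs : ∀ v : ZMod 2, ((signChar v : ℤ) : ℂ) = (-1 : ℂ) ^ v.val := by
    intro v; simp [signChar]
  have : NeZero m := ⟨hm.ne'⟩
  constructor
  · rintro ⟨f, hf⟩
    refine ⟨fun x => zetaRoot m ^ (f x).val, fun x => ?_, fun y => ?_⟩
    · rw [← pow_mul, mul_comm, pow_mul, hz.pow_eq_one, one_pow]
    · have h := hf y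
      simp only [walsh, hs]
      exact h
  · rintro ⟨g, hg, hw⟩
    choose i hi hgi using fun x => hz.eq_pow_of_pow_eq_one (hg x)
    refine ⟨fun x => (i x : ZMod m), fun y => ?_⟩
    have : gbfTransform (fun x => (i x : ZMod m)) y = walsh g y := by
      refine Finset.sum_congr rfl fun x _ => ?_
      rw [ZMod.val_natCast_of_lt (hi x), hgi, hs]
    rw [this]; exact hw y

lemma existsGBF_iff_autocorr {m n : ℕ} (hm : 0 < m) :
    ExistsGBF m n ↔ ∃ g : (Fin n → ZMod 2) → ℂ, (∀ x, g x ^ m = 1) ∧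
      ∀ a, a ≠ 0 → autocorr g a = 0 := by
  rw [existsGBF_iff_walsh hm]
  refine exists_congr fun g => and_congr_right fun hg => walsh_normSq_iff g fun x => ?_
  exact Complex.norm_eq_one_of_pow_eq_one (hg x) hm.ne'

/-! ### Integral Walsh values of sign functions: Parseval and congruences. -/

/-- The integral Walsh–Hadamard transform. -/
def intWalsh {n : ℕ} (d : (Fin n → ZMod 2) → ℤ) (y : Fin n → ZMod 2) : ℤ :=
  ∑ x, d x * signChar (dotProduct y x)

lemma sum_intWalsh_sq {n : ℕ} (d : (Fin n → ZMod 2) → ℤ) (hd : ∀ x, d x = 1 ∨ d x = -1) :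
    ∑ y, intWalsh d y ^ 2 = 2 ^ n * 2 ^ n := by
  have h := sum_walsh_mul_conj (fun x => (d x : ℂ)) 0
  have h1 : ∀ y, walsh (fun x => (d x : ℂ)) y = (intWalsh d y : ℂ) := by
    intro y; simp [walsh, intWalsh]
  have h2 : ∀ x, (d x : ℂ) * d x = 1 := by
    intro x; rcases hd x with h | h <;> simp [h]
  simp only [h1, autocorr, map_intCast, dotProduct_zero, signChar_zero, add_zero, h2] at h
  simp only [Int.cast_one, mul_one, Finset.sum_const, Finset.card_univ, Fintype.card_pi,
    ZMod.card, Finset.prod_const, Fintype.card_fin, nsmul_eq_mul] at h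
  simp only [← pow_two (Int.cast _ : ℂ)] at h
  exact_mod_cast h

lemma even_intWalsh {n : ℕ} (hn : 0 < n) (d : (Fin n → ZMod 2) → ℤ)
    (hd : ∀ x, d x = 1 ∨ d x = -1) (y : Fin n → ZMod 2) : (2 : ℤ) ∣ intWalsh d y := by
  have h : (2 : ℤ) ∣ ∑ x, (d x * signChar (dotProduct y x) - 1) := by
    refine Finset.dvd_sum fun x _ => ?_
    rcases hd x with h | h <;> rcases signChar_eq_or (dotProduct y x) with h' | h' <;>
      rw [h, h'] <;> decide
  rw [Finset.sum_sub_distrib] at h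
  refine (Int.dvd_iff_dvd_of_dvd_sub h).mpr ?_
  simpa using dvd_pow_self (2 : ℤ) hn.ne'

/-- With `χ` the character of `y`, `d * χ - d = (d - 1) * (χ - 1) + (χ - 1)`. The product is a
multiple of `4`, and so is the sum of the `χ - 1`, by orthogonality and `n ≥ 2`. -/
lemma four_dvd_intWalsh_sub {n : ℕ} (hn : 2 ≤ n) (d : (Fin n → ZMod 2) → ℤ)
    (hd : ∀ x, d x = 1 ∨ d x = -1) (y y' : Fin n → ZMod 2) :
    (4 : ℤ) ∣ intWalsh d y - intWalsh d y' := by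
  have h4 : (4 : ℤ) ∣ 2 ^ n := by
    simpa using pow_dvd_pow (2 : ℤ) hn
  have key : ∀ y, (4 : ℤ) ∣ intWalsh d y - ∑ x, d x := by
    intro y
    have h1 : (4 : ℤ) ∣ ∑ x, (d x - 1) * (signChar (dotProduct y x) - 1) := by
      refine Finset.dvd_sum fun x _ => ?_
      rcases hd x with h | h <;> rcases signChar_eq_or (dotProduct y x) with h' | h' <;>
        rw [h, h'] <;> decide
    have h2 : (4 : ℤ) ∣ ∑ x, (signChar (dotProduct y x) - 1) := by
      rw [Finset.sum_sub_distrib]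
      simp only [dotProduct_comm y]
      rw [sum_signChar_dotProduct]
      refine dvd_sub ?_ (by simpa using h4)
      split_ifs
      · exact h4
      · exact dvd_zero _
    have h3 : intWalsh d y - ∑ x, d x = ∑ x, (d x - 1) * (signChar (dotProduct y x) - 1)
        + ∑ x, (signChar (dotProduct y x) - 1) := by
      rw [intWalsh, ← Finset.sum_sub_distrib, ← Finset.sum_add_distrib]
      exact Finset.sum_congr rfl fun x _ => by ring
    rw [h3]
    exact dvd_add h1 h2
  have := dvd_sub (key y) (key y')
  simpa using this

/-! ### Vanishing sums of roots of unity. -/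

open Polynomial in
/-- The Galois action on a vanishing sum of roots of unity. -/
lemma sum_pow_eq_zero_of_coprime {ι : Type*} {M : ℕ} (hM : 0 < M) (s : Finset ι) (z : ι → ℂ)
    (hz : ∀ i, z i ^ M = 1) (h : ∑ i ∈ s, z i = 0) {e : ℕ} (he : e.Coprime M) :
    ∑ i ∈ s, z i ^ e = 0 := by
  have hζ := Complex.isPrimitiveRoot_exp M hM.ne'
  set ζ := Complex.exp (2 * Real.pi * Complex.I / M)
  have : NeZero M := ⟨hM.ne'⟩
  choose k hk hkz using fun i => hζ.eq_pow_of_pow_eq_one (hz i)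
  have h1 : aeval ζ (∑ i ∈ s, (X : ℤ[X]) ^ k i) = 0 := by
    simpa [map_sum, hkz] using h
  obtain ⟨R, hR⟩ := minpoly.isIntegrallyClosed_dvd (hζ.isIntegral hM) h1
  have h2 : aeval (ζ ^ e) (minpoly ℤ ζ) = 0 := by
    have := hζ.pow_isRoot_minpoly he
    rwa [IsRoot, eval_map, ← algebraMap_int_eq, ← aeval_def] at this
  have h3 : aeval (ζ ^ e) (∑ i ∈ s, (X : ℤ[X]) ^ k i) = 0 := by
    rw [hR, map_mul, h2, zero_mul]
  rw [map_sum] at h3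
  rw [← h3]
  refine Finset.sum_congr rfl fun i _ => ?_
  rw [← hkz i, map_pow, aeval_X, ← pow_mul, ← pow_mul, mul_comm]

lemma exists_stdAddChar_eq {q : ℕ} [NeZero q] {z : ℂ} (hz : z ^ q = 1) :
    ∃ j : ZMod q, z = ZMod.stdAddChar j := by
  obtain ⟨i, -, hi⟩ := (Complex.isPrimitiveRoot_exp q (NeZero.ne q)).eq_pow_of_pow_eq_one hz
  refine ⟨((i : ℤ) : ZMod q), ?_⟩
  rw [ZMod.stdAddChar_coe, ← hi, ← Complex.exp_nat_mul]
  congr 1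
  push_cast; ring

lemma stdAddChar_pow_eq_one {q : ℕ} [NeZero q] (j : ZMod q) :
    (ZMod.stdAddChar j : ℂ) ^ q = 1 := by
  rw [← AddChar.map_nsmul_eq_pow]
  simp

/-- A root of unity of order dividing `N * q`, with `N` and `q` coprime, splits as a product. -/
lemma exists_eq_mul_stdAddChar {N q : ℕ} [NeZero q] (hNq : N.Coprime q) {z : ℂ}
    (hz : z ^ (N * q) = 1) : ∃ w : ℂ, ∃ j : ZMod q, w ^ N = 1 ∧ z = w * ZMod.stdAddChar j := by
  obtain ⟨e, he1, he2⟩ := Nat.chineseRemainder hNq 1 0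
  obtain ⟨e', he1', he2'⟩ := Nat.chineseRemainder hNq 0 1
  have hw : (z ^ e) ^ N = 1 := by
    obtain ⟨c, rfl⟩ := (Nat.modEq_zero_iff_dvd).mp he2
    rw [← pow_mul, show q * c * N = N * q * c by ring, pow_mul, hz, one_pow]
  have hq : (z ^ e') ^ q = 1 := by
    obtain ⟨c, rfl⟩ := (Nat.modEq_zero_iff_dvd).mp he1'
    rw [← pow_mul, show N * c * q = N * q * c by ring, pow_mul, hz, one_pow]
  obtain ⟨j, hj⟩ := exists_stdAddChar_eq hq
  refine ⟨z ^ e, j, hw, ?_⟩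
  rw [← hj, ← pow_add]
  have hmod : e + e' ≡ 1 [MOD N * q] :=
    (Nat.modEq_and_modEq_iff_modEq_mul hNq).mp
      ⟨by simpa using he1.add he1', by simpa using he2.add he2'⟩
  rw [pow_eq_pow_of_modEq hmod hz, pow_one]

section Coset

variable {ι : Type*} {p l N : ℕ}

/-- In a vanishing sum of products of `N`-th roots of unity and `p ^ (l + 1)`-th roots of unity, with
`p` prime to `N`, the coefficients are constant on the cosets of the subgroup of order `p`. -/
lemma sum_filter_eq_sum_filter_add [NeZero (p ^ (l + 1))] (hp : p.Prime) (hN : 0 < N) (hpN : p.Coprime N)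
    (s : Finset ι) (w : ι → ℂ) (hw : ∀ i, w i ^ N = 1) (j : ι → ZMod (p ^ (l + 1)))
    (h : ∑ i ∈ s, w i * ZMod.stdAddChar (j i) = 0) (c : ZMod (p ^ (l + 1))) :
    ∑ i ∈ s with j i = c + (p : ZMod (p ^ (l + 1))) ^ l, w i = ∑ i ∈ s with j i = c, w i := by
  set ψ : AddChar (ZMod (p ^ (l + 1))) ℂ := ZMod.stdAddChar with hψ
  set A : ZMod (p ^ (l + 1)) → ℂ := fun t => ∑ i ∈ s, w i * ψ (t * j i) with hA
  -- For a unit `t`, `A t` is a Galois conjugate of the given sum, by an automorphism fixing the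
  -- `N`-th roots of unity.
  have hunit : ∀ t, IsUnit t → A t = 0 := by
    intro t ht
    have hqN : (p ^ (l + 1)).Coprime N := hpN.pow_left _
    obtain ⟨e, he1, he2⟩ := Nat.chineseRemainder hqN t.val 1
    have htc : t.val.Coprime (p ^ (l + 1)) := by
      rw [← ZMod.isUnit_iff_coprime, ZMod.natCast_zmod_val]; exact ht
    have hec : e.Coprime (p ^ (l + 1) * N) := by
      refine Nat.Coprime.mul_right ?_ ?_
      · rw [Nat.Coprime, he1.gcd_eq]; exact htc
      · rw [Nat.Coprime, he2.gcd_eq]; simp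
    have h1 := sum_pow_eq_zero_of_coprime (M := p ^ (l + 1) * N)
      (Nat.mul_pos (NeZero.pos _) hN) s (fun i => w i * ψ (j i)) (fun i => by
        rw [mul_pow, pow_mul (ψ (j i)), stdAddChar_pow_eq_one, one_pow, mul_comm (p ^ (l + 1)),
          pow_mul, hw, one_pow, one_mul]) h hec
    rw [← h1]
    refine Finset.sum_congr rfl fun i _ => ?_
    rw [mul_pow, ← AddChar.map_nsmul_eq_pow, nsmul_eq_mul]
    have h2 : (e : ZMod (p ^ (l + 1))) = t := by
      rw [(ZMod.natCast_eq_natCast_iff _ _ _).mpr he1, ZMod.natCast_zmod_val]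
    have h3 : w i ^ e = w i := by
      rw [pow_eq_pow_of_modEq he2 (hw i), pow_one]
    rw [h2, h3]
  have hinv : ∀ c, ∑ t, A t * ψ (-(t * c))
      = (p ^ (l + 1) : ℕ) * ∑ i ∈ s with j i = c, w i := by
    intro c
    have h1 : ∀ t, A t * ψ (-(t * c)) = ∑ i ∈ s, w i * ψ (t * (j i - c)) := by
      intro t
      rw [hA, Finset.sum_mul]
      refine Finset.sum_congr rfl fun i _ => ?_
      rw [mul_assoc, ← AddChar.map_add_eq_mul]
      congr 2; ring
    simp only [h1]
    rw [Finset.sum_comm, Finset.mul_sum, Finset.sum_filter]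
    refine Finset.sum_congr rfl fun i _ => ?_
    rw [← Finset.mul_sum, AddChar.sum_mulShift _ (ZMod.isPrimitive_stdAddChar _), ZMod.card]
    simp only [sub_eq_zero]
    split_ifs <;> simp [mul_comm]
  have hq : ((p ^ (l + 1) : ℕ) : ℂ) ≠ 0 := by exact_mod_cast NeZero.ne (p ^ (l + 1))
  refine mul_left_cancel₀ hq ?_
  rw [← hinv, ← hinv]
  refine Finset.sum_congr rfl fun t _ => ?_
  by_cases ht : IsUnit t
  · rw [hunit t ht, zero_mul, zero_mul]
  -- Only non-units contribute to the Fourier inversion; they are multiples of `p`, so their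
  -- characters do not see the shift by `p ^ l`.
  · have h0 : t * (p : ZMod (p ^ (l + 1))) ^ l = 0 := by
      rw [← ZMod.natCast_zmod_val t, ZMod.isUnit_iff_coprime,
        Nat.coprime_pow_right_iff (Nat.succ_pos l), Nat.coprime_comm,
        Nat.Prime.coprime_iff_not_dvd hp, not_not] at ht
      obtain ⟨b, hb⟩ := ht
      rw [← ZMod.natCast_zmod_val t, hb]
      have : ((p ^ (l + 1) : ℕ) : ZMod (p ^ (l + 1))) = 0 := ZMod.natCast_self _
      push_cast at this ⊢
      linear_combination (b : ZMod (p ^ (l + 1))) * this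
    rw [mul_add, h0, add_zero]

/-- The coset of `c` modulo the subgroup of order `p` of `ℤ/p^(l+1)`. -/
def pCoset (p l : ℕ) (c : ZMod (p ^ (l + 1))) : Finset (ZMod (p ^ (l + 1))) :=
  (Finset.range p).image fun t : ℕ => c + (t : ZMod (p ^ (l + 1))) * (p : ZMod (p ^ (l + 1))) ^ l

lemma injOn_pCoset (hp : 0 < p) (c : ZMod (p ^ (l + 1))) :
    Set.InjOn (fun t : ℕ => c + (t : ZMod (p ^ (l + 1))) * (p : ZMod (p ^ (l + 1))) ^ l)
      (Finset.range p) := by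
  intro t ht t' ht' h
  have h1 : ((t * p ^ l : ℕ) : ZMod (p ^ (l + 1))) = ((t' * p ^ l : ℕ) : ZMod (p ^ (l + 1))) := by
    push_cast; exact add_left_cancel h
  have hlt : ∀ t ∈ Finset.range p, t * p ^ l < p ^ (l + 1) := by
    intro t ht
    rw [pow_succ']
    exact Nat.mul_lt_mul_of_pos_right (Finset.mem_range.mp ht) (pow_pos hp l)
  rw [ZMod.natCast_eq_natCast_iff', Nat.mod_eq_of_lt (hlt t ht), Nat.mod_eq_of_lt (hlt t' ht')] at h1
  exact Nat.eq_of_mul_eq_mul_right (pow_pos hp l) h1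

lemma card_pCoset (hp : 0 < p) (c : ZMod (p ^ (l + 1))) : (pCoset p l c).card = p := by
  rw [pCoset, Finset.card_image_of_injOn (injOn_pCoset hp c), Finset.card_range]

lemma sum_filter_eq_of_mem_pCoset [NeZero (p ^ (l + 1))] (hp : p.Prime) (hN : 0 < N) (hpN : p.Coprime N)
    (s : Finset ι) (w : ι → ℂ) (hw : ∀ i, w i ^ N = 1) (j : ι → ZMod (p ^ (l + 1)))
    (h : ∑ i ∈ s, w i * ZMod.stdAddChar (j i) = 0) (c c' : ZMod (p ^ (l + 1)))
    (hc' : c' ∈ pCoset p l c) :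
    ∑ i ∈ s with j i = c', w i = ∑ i ∈ s with j i = c, w i := by
  obtain ⟨t, -, rfl⟩ := Finset.mem_image.mp hc'
  clear hc'
  induction t with
  | zero => simp
  | succ t ih =>
    rw [← ih, ← sum_filter_eq_sum_filter_add hp hN hpN s w hw j h
      (c + (t : ZMod (p ^ (l + 1))) * (p : ZMod (p ^ (l + 1))) ^ l)]
    simp only [Nat.cast_succ, add_mul, one_mul, add_assoc]

lemma sum_stdAddChar_pCoset [NeZero (p ^ (l + 1))] (hp : p.Prime) (c : ZMod (p ^ (l + 1))) :
    ∑ x ∈ pCoset p l c, (ZMod.stdAddChar x : ℂ) = 0 := by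
  set ω : ℂ := ZMod.stdAddChar ((p : ZMod (p ^ (l + 1))) ^ l) with hω
  have h1 : ω ^ p = 1 := by
    rw [hω, ← AddChar.map_nsmul_eq_pow, nsmul_eq_mul, ← pow_succ', ← Nat.cast_pow,
      ZMod.natCast_self, AddChar.map_zero_eq_one]
  have h2 : ω ≠ 1 := by
    intro h
    have h3 : (p : ZMod (p ^ (l + 1))) ^ l = 0 :=
      ZMod.injective_stdAddChar (h.trans (AddChar.map_zero_eq_one _).symm)
    rw [← Nat.cast_pow, ZMod.natCast_eq_zero_iff, Nat.pow_dvd_pow_iff_le_right hp.one_lt] at h3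
    omega
  rw [pCoset, Finset.sum_image (injOn_pCoset hp.pos c)]
  have h3 : ∑ t ∈ Finset.range p, ω ^ t = 0 := by
    rw [geom_sum_eq h2, h1, sub_self, zero_div]
  have h4 : ∀ t : ℕ, (ZMod.stdAddChar (c + (t : ZMod (p ^ (l + 1))) * (p : ZMod (p ^ (l + 1))) ^ l) : ℂ)
      = ZMod.stdAddChar c * ω ^ t := by
    intro t
    rw [AddChar.map_add_eq_mul, hω, ← AddChar.map_nsmul_eq_pow, nsmul_eq_mul]
  simp only [h4, ← Finset.mul_sum, h3, mul_zero]

end Coset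

/-- A vanishing sum of an odd number of `2m`-th roots of unity, `m` odd, has at least as many terms
as the least prime divisor of `m`. -/
lemma le_card_of_odd_vanishing_sum {ι : Type*} (q : ℕ) (m : ℕ) (hm : Odd m)
    (hq : ∀ p : ℕ, p.Prime → p ∣ m → q ≤ p) (s : Finset ι) (z : ι → ℂ)
    (hz : ∀ i, z i ^ (2 * m) = 1) (h : ∑ i ∈ s, z i = 0) (hs : Odd s.card) : q ≤ s.card := by
  induction m using Nat.strong_induction_on generalizing s z with
  | _ m ih =>
  by_cases hm1 : m = 1
  · exfalso
    subst hm1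
    have h1 : ∀ i, ∃ d : ℤ, z i = d ∧ (2 : ℤ) ∣ d - 1 := by
      intro i
      rcases mul_self_eq_one_iff.mp (by simpa [pow_two] using hz i) with h | h
      · exact ⟨1, by simp [h], by norm_num⟩
      · exact ⟨-1, by simp [h], by norm_num⟩
    choose d hd hd2 using h1
    have h2 : ∑ i ∈ s, d i = 0 := by
      have : ((∑ i ∈ s, d i : ℤ) : ℂ) = 0 := by rw [← h]; push_cast; simp [hd]
      exact_mod_cast this
    have h3 : (2 : ℤ) ∣ ∑ i ∈ s, (d i - 1) := Finset.dvd_sum fun i _ => hd2 i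
    rw [Finset.sum_sub_distrib, h2] at h3
    simp only [Finset.sum_const, nsmul_eq_mul, mul_one, zero_sub, dvd_neg] at h3
    obtain ⟨c, hc⟩ := hs
    omega
  · have hm0 : m ≠ 0 := by rintro rfl; simp at hm
    obtain ⟨p, hpdef⟩ : ∃ p, p = m.minFac := ⟨_, rfl⟩
    have hp : p.Prime := hpdef ▸ Nat.minFac_prime hm1
    have hpm : p ∣ m := hpdef ▸ Nat.minFac_dvd m
    obtain ⟨k, m', hpm', hmk⟩ := Nat.exists_eq_pow_mul_and_not_dvd hm0 p hp.ne_one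
    have hk : k ≠ 0 := by
      rintro rfl
      apply hpm'
      rw [pow_zero, one_mul] at hmk
      rw [← hmk]; exact hpm
    obtain ⟨l, rfl⟩ := Nat.exists_eq_succ_of_ne_zero hk
    rw [Nat.succ_eq_add_one] at hmk
    have hm'0 : 0 < m' := Nat.pos_of_ne_zero fun h0 => hm0 (by rw [hmk, h0, mul_zero])
    have : NeZero (p ^ (l + 1)) := ⟨pow_ne_zero _ hp.ne_zero⟩
    have hpodd : p ≠ 2 := by
      intro h2
      have : 2 ∣ m := h2 ▸ hpm
      exact (Nat.not_even_iff_odd.mpr hm) (even_iff_two_dvd.mpr this)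
    have hcop : p.Coprime (2 * m') := Nat.Coprime.mul_right
      ((Nat.coprime_primes hp Nat.prime_two).mpr hpodd) ((Nat.Prime.coprime_iff_not_dvd hp).mpr hpm')
    have hm'm : m' ∣ m := Dvd.intro_left _ hmk.symm
    have hm'odd : Odd m' := hm.of_dvd_nat hm'm
    choose w j hw hwj using fun i => exists_eq_mul_stdAddChar (N := 2 * m') (q := p ^ (l + 1))
      (Nat.Coprime.pow_right _ hcop.symm) (z := z i)
      (by rw [← hz i, hmk]; congr 1; ring)
    simp only [hwj] at h
    have hodd : ∃ c, Odd (s.filter fun i => j i = c).card := by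
      by_contra hcon
      push Not at hcon
      rw [Finset.card_eq_sum_card_fiberwise (f := j) (t := Finset.univ) (by simp)] at hs
      exact (Nat.not_even_iff_odd.mpr hs) (Finset.even_sum _ fun c _ => Nat.not_odd_iff_even.mp (hcon c))
    obtain ⟨c, hc⟩ := hodd
    -- Either this odd fibre is a vanishing sum of smaller order, or all `p` fibres over the coset
    -- of `c` have the same nonzero sum and so are nonempty.
    by_cases ha : ∑ i ∈ s with j i = c, w i = 0
    · refine (ih m' ?_ hm'odd (fun r hr hrm => hq r hr (hrm.trans hm'm)) _ w hw ha hc).trans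
        (Finset.card_filter_le _ _)
      rw [hmk]
      exact lt_mul_of_one_lt_left hm'0 (Nat.one_lt_pow (Nat.succ_ne_zero l) hp.one_lt)
    · have hsub : pCoset p l c ⊆ s.image j := by
        intro c' hc'
        have h1 := sum_filter_eq_of_mem_pCoset hp (by omega) hcop s w hw j h c c' hc'
        rw [← h1] at ha
        obtain ⟨i, hi, -⟩ := Finset.exists_ne_zero_of_sum_ne_zero ha
        rw [Finset.mem_filter] at hi
        exact Finset.mem_image.mpr ⟨i, hi⟩
      calc q ≤ p := hq p hp hpm
        _ = (pCoset p l c).card := (card_pCoset hp.pos c).symm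
        _ ≤ (s.image j).card := Finset.card_le_card hsub
        _ ≤ s.card := Finset.card_image_le

/-- In a vanishing sum of an even number of products of `2m`-th roots of unity and
`p ^ (l + 1)`-th roots of unity which is shorter than `p + q - 2`, where the prime divisors of `m`
are at least `q`, the `p ^ (l + 1)`-th roots of unity may be replaced by `1`. -/
lemma sum_eq_zero_of_card_lt {ι : Type*} {p l m q : ℕ} [NeZero (p ^ (l + 1))] (hp : p.Prime)
    (hp2 : p ≠ 2) (hm : Odd m) (hpm : ¬ p ∣ m) (hq : ∀ r : ℕ, r.Prime → r ∣ m → q ≤ r) (hqp : q ≤ p)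
    (s : Finset ι) (hs : Even s.card) (hcard : s.card + 2 < p + q) (w : ι → ℂ)
    (hw : ∀ i, w i ^ (2 * m) = 1) (j : ι → ZMod (p ^ (l + 1)))
    (h : ∑ i ∈ s, w i * ZMod.stdAddChar (j i) = 0) : ∑ i ∈ s, w i = 0 := by
  classical
  have hcop : p.Coprime (2 * m) := Nat.Coprime.mul_right
    ((Nat.coprime_primes hp Nat.prime_two).mpr hp2) ((Nat.Prime.coprime_iff_not_dvd hp).mpr hpm)
  have hm0 : 0 < m := hm.pos
  rw [← Finset.sum_fiberwise s j]
  refine Finset.sum_eq_zero fun c _ => ?_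
  by_contra ha
  set T := pCoset p l c with hT
  have hTcard : T.card = p := card_pCoset hp.pos c
  have hconst : ∀ c' ∈ T, ∑ i ∈ s with j i = c', w i = ∑ i ∈ s with j i = c, w i :=
    fun c' hc' => sum_filter_eq_of_mem_pCoset hp (by omega) hcop s w hw j h c c' hc'
  set n : ZMod (p ^ (l + 1)) → ℕ := fun c' => (s.filter fun i => j i = c').card with hn
  have hn1 : ∀ c' ∈ T, 1 ≤ n c' := by
    intro c' hc'
    rw [← hconst c' hc'] at ha
    obtain ⟨i, hi, -⟩ := Finset.exists_ne_zero_of_sum_ne_zero ha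
    exact Finset.card_pos.mpr ⟨i, hi⟩
  have hsumT : ∑ c' ∈ T, n c' = (s.filter fun i => j i ∈ T).card := by
    rw [Finset.card_eq_sum_card_fiberwise (f := j) (t := T)
      (by intro i hi; exact (Finset.mem_filter.mp hi).2)]
    refine Finset.sum_congr rfl fun c' hc' => ?_
    simp only [hn, Finset.filter_filter]
    congr 1
    ext i
    simp only [Finset.mem_filter]
    constructor
    · rintro ⟨h1, rfl⟩; exact ⟨h1, hc', rfl⟩
    · rintro ⟨h1, -, h2⟩; exact ⟨h1, h2⟩
  have hsplit := Finset.card_filter_add_card_filter_not (s := s) (fun i => j i ∈ T)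
  -- Otherwise there would be at least `2p ≥ p + q` terms. The common fibre sum over `T` is
  -- therefore a single root of unity `w i₁`.
  have hone : ∃ c₁ ∈ T, n c₁ = 1 := by
    by_contra hcon
    push Not at hcon
    have : T.card • 2 ≤ ∑ c' ∈ T, n c' := Finset.card_nsmul_le_sum _ _ _ fun c' hc' => by
      have := hn1 c' hc'; have := hcon c' hc'; omega
    rw [hTcard, smul_eq_mul] at this
    omega
  obtain ⟨c₁, hc₁, hnc₁⟩ := hone
  obtain ⟨i₁, hi₁⟩ := Finset.card_eq_one.mp hnc₁
  have hu : ∑ i ∈ s with j i = c, w i = w i₁ := by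
    rw [← hconst c₁ hc₁, hi₁, Finset.sum_singleton]
  -- Appending `-w i₁` to an even fibre gives a vanishing sum of odd length.
  have hdich : ∀ c' ∈ T, Odd (n c') ∨ q ≤ n c' + 1 := by
    intro c' hc'
    rw [or_iff_not_imp_left, Nat.not_odd_iff_even]
    intro heven
    have hcd : (Finset.insertNone (s.filter fun i => j i = c')).card = n c' + 1 :=
      Finset.card_insertNone _
    rw [← hcd]
    refine le_card_of_odd_vanishing_sum q m hm hq _
      (fun o : Option ι => o.elim (-w i₁) w) ?_ ?_ ?_
    · rintro (_ | i)
      · simp [pow_mul, ← hw i₁]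
      · exact hw i
    · rw [Finset.sum_insertNone]
      simp [hconst c' hc', hu]
    · rw [hcd]; exact heven.add_one
  -- If all fibres over `T` are odd, the part over `T` vanishes by itself and has odd length at
  -- least `p`; the rest is an odd vanishing sum, of length at least `q`. An even fibre instead
  -- forces at least `(q - 1) + (p - 1)` terms.
  by_cases hall : ∀ c' ∈ T, Odd (n c')
  · have hTodd : Odd (∑ c' ∈ T, n c') := by
      rw [Finset.odd_sum_iff_odd_card_odd, Finset.filter_true_of_mem hall, hTcard]
      exact hp.odd_of_ne_two hp2
    have hTge : T.card • 1 ≤ ∑ c' ∈ T, n c' := Finset.card_nsmul_le_sum _ _ _ hn1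
    rw [hTcard, smul_eq_mul, mul_one] at hTge
    have hT0 : ∑ i ∈ s with j i ∈ T, w i * (ZMod.stdAddChar (j i) : ℂ) = 0 := by
      rw [← Finset.sum_fiberwise_of_maps_to (t := T) (g := j)
        (by intro i hi; exact (Finset.mem_filter.mp hi).2)]
      have : ∀ c' ∈ T, ∑ i ∈ (s.filter fun i => j i ∈ T) with j i = c',
          w i * (ZMod.stdAddChar (j i) : ℂ) = w i₁ * ZMod.stdAddChar c' := by
        intro c' hc'
        rw [← hu, ← hconst c' hc', Finset.sum_mul, Finset.filter_filter]
        refine Finset.sum_congr ?_ ?_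
        · ext i
          simp only [Finset.mem_filter]
          constructor
          · rintro ⟨h1, -, h2⟩; exact ⟨h1, h2⟩
          · rintro ⟨h1, rfl⟩; exact ⟨h1, hc', rfl⟩
        · intro i hi
          rw [(Finset.mem_filter.mp hi).2]
      rw [Finset.sum_congr rfl this, ← Finset.mul_sum, sum_stdAddChar_pCoset hp, mul_zero]
    have hS0 : ∑ i ∈ s with j i ∉ T, w i * (ZMod.stdAddChar (j i) : ℂ) = 0 := by
      have := Finset.sum_filter_add_sum_filter_not s (fun i => j i ∈ T)
        (fun i => w i * (ZMod.stdAddChar (j i) : ℂ))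
      rw [hT0, h, zero_add] at this
      exact this
    have hSodd : Odd (s.filter fun i => j i ∉ T).card := by
      rw [← hsplit] at hs
      rw [hsumT] at hTodd
      by_contra hcon
      rw [Nat.not_odd_iff_even] at hcon
      exact (Nat.not_even_iff_odd.mpr (hTodd.add_even hcon)) hs
    have hSge := le_card_of_odd_vanishing_sum q (m * p ^ (l + 1))
      (hm.mul ((hp.odd_of_ne_two hp2).pow)) (by
        intro r hr hrd
        rcases (Nat.Prime.dvd_mul hr).mp hrd with h1 | h1
        · exact hq r hr h1
        · rw [(Nat.prime_dvd_prime_iff_eq hr hp).mp (hr.dvd_of_dvd_pow h1)]; exact hqp)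
      _ (fun i => w i * (ZMod.stdAddChar (j i) : ℂ)) (fun i => by
        rw [mul_pow, ← mul_assoc, pow_mul (w i), hw, one_pow, mul_comm (2 * m), pow_mul,
          stdAddChar_pow_eq_one, one_pow, one_mul]) hS0 hSodd
    omega
  · push Not at hall
    obtain ⟨c₂, hc₂, hc₂n⟩ := hall
    have h2 := (hdich c₂ hc₂).resolve_left (by simpa using hc₂n)
    have h3 := Finset.add_sum_erase T n hc₂
    have h4 : (T.erase c₂).card • 1 ≤ ∑ c' ∈ T.erase c₂, n c' :=
      Finset.card_nsmul_le_sum _ _ _ fun c' hc' => hn1 c' (Finset.mem_of_mem_erase hc')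
    rw [Finset.card_erase_of_mem hc₂, hTcard, smul_eq_mul, mul_one] at h4
    have := hp.pos
    omega

/-! ### Removing a prime from the order. -/

/-- Descent: a prime power `p ^ (l + 1)` can be removed from the order of a generalized bent
function when `p` is large compared with `2 ^ n`. -/
lemma ExistsGBF.of_mul_prime_pow {p l m q n : ℕ} (hn : 0 < n) (hp : p.Prime) (hp2 : p ≠ 2)
    (hm : Odd m) (hpm : ¬ p ∣ m) (hq : ∀ r : ℕ, r.Prime → r ∣ m → q ≤ r) (hqp : q ≤ p)
    (hcard : 2 ^ n + 2 < p + q) (h : ExistsGBF (2 * (m * p ^ (l + 1))) n) :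
    ExistsGBF (2 * m) n := by
  have : NeZero (p ^ (l + 1)) := ⟨pow_ne_zero _ hp.ne_zero⟩
  have hm0 : 0 < m := hm.pos
  rw [existsGBF_iff_autocorr (Nat.mul_pos two_pos (Nat.mul_pos hm0 (NeZero.pos _)))] at h
  rw [existsGBF_iff_autocorr (by omega)]
  obtain ⟨g, hg, hac⟩ := h
  have hcop : p.Coprime (2 * m) := Nat.Coprime.mul_right
    ((Nat.coprime_primes hp Nat.prime_two).mpr hp2) ((Nat.Prime.coprime_iff_not_dvd hp).mpr hpm)
  choose w j hw hwj using fun x => exists_eq_mul_stdAddChar (N := 2 * m) (q := p ^ (l + 1))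
    (Nat.Coprime.pow_right _ hcop.symm) (z := g x) (by rw [← hg x, mul_assoc])
  refine ⟨w, hw, fun a ha => ?_⟩
  have h1 := hac a ha
  simp only [autocorr, hwj] at h1
  have hV : (Finset.univ : Finset (Fin n → ZMod 2)).card = 2 ^ n := by simp
  refine sum_eq_zero_of_card_lt hp hp2 hm hpm hq hqp Finset.univ
    (by rw [hV]; exact (even_two).pow_of_ne_zero hn.ne') (by rw [hV]; exact hcard)
    (fun x => w x * (starRingEnd ℂ) (w (x + a))) (fun x => by
      rw [mul_pow, ← map_pow, hw, hw, map_one, one_mul]) (fun x => j x - j (x + a)) ?_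
  rw [← h1]
  refine Finset.sum_congr rfl fun x _ => ?_
  rw [map_mul, ← AddChar.map_neg_eq_conj, sub_eq_add_neg, AddChar.map_add_eq_mul]
  ring

/-! ### Reduction modulo `p` for a single odd prime. -/

lemma stdAddChar_eq_pow {q : ℕ} [NeZero q] (j : ZMod q) :
    (ZMod.stdAddChar j : ℂ) = Complex.exp (2 * Real.pi * Complex.I / q) ^ j.val := by
  conv_lhs => rw [← ZMod.natCast_zmod_val j, ← Int.cast_natCast, ZMod.stdAddChar_coe]
  rw [← Complex.exp_nat_mul]
  congr 1
  push_cast; ring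

open Polynomial in
/-- Reduction of the bent condition modulo the prime above `p` of the `p ^ (l + 1)`-th cyclotomic
field. -/
lemma ExistsGBF.exists_intWalsh {p l n : ℕ} (hp : p.Prime) (hp2 : p ≠ 2)
    (h : ExistsGBF (2 * p ^ (l + 1)) n) :
    ∃ d : (Fin n → ZMod 2) → ℤ, (∀ x, d x = 1 ∨ d x = -1) ∧
      ∀ y, (p : ℤ) ∣ intWalsh d y ^ 2 - 2 ^ n := by
  have hq0 : 0 < p ^ (l + 1) := pow_pos hp.pos _
  have : NeZero (p ^ (l + 1)) := ⟨hq0.ne'⟩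
  rw [existsGBF_iff_walsh (by omega)] at h
  obtain ⟨g, hg, hW⟩ := h
  choose w j hw hwj using fun x => exists_eq_mul_stdAddChar (N := 2) (q := p ^ (l + 1))
    (Nat.Coprime.pow_right _ ((Nat.coprime_primes Nat.prime_two hp).mpr hp2.symm)) (z := g x) (hg x)
  have h1 : ∀ x, ∃ d : ℤ, (d = 1 ∨ d = -1) ∧ w x = d := by
    intro x
    rcases mul_self_eq_one_iff.mp ((pow_two _).symm.trans (hw x)) with h | h
    · exact ⟨1, Or.inl rfl, by simp [h]⟩
    · exact ⟨-1, Or.inr rfl, by simp [h]⟩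
  choose d hd hdw using h1
  refine ⟨d, hd, fun y => ?_⟩
  have hζ := Complex.isPrimitiveRoot_exp (p ^ (l + 1)) hq0.ne'
  set ζ := Complex.exp (2 * Real.pi * Complex.I / (p ^ (l + 1) : ℕ)) with hζdef
  set P : ℤ[X] := ∑ x, C (d x * signChar (dotProduct y x)) * X ^ (j x).val with hP
  set P' : ℤ[X] := ∑ x, C (d x * signChar (dotProduct y x)) * X ^ (-(j x)).val with hP'
  have e1 : aeval ζ P = walsh g y := by
    rw [hP, map_sum, walsh]
    refine Finset.sum_congr rfl fun x _ => ?_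
    rw [hwj, hdw, stdAddChar_eq_pow]
    simp [hζdef]
    ring
  have e2 : aeval ζ P' = (starRingEnd ℂ) (walsh g y) := by
    rw [hP', map_sum, walsh, map_sum]
    refine Finset.sum_congr rfl fun x _ => ?_
    rw [hwj, hdw, map_mul (starRingEnd ℂ), map_mul (starRingEnd ℂ), ← AddChar.map_neg_eq_conj,
      stdAddChar_eq_pow]
    simp [hζdef]
    ring
  have e3 : aeval ζ (P * P' - C (2 ^ n)) = 0 := by
    rw [map_sub, map_mul, e1, e2, Complex.mul_conj, Complex.normSq_eq_norm_sq, hW,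
      aeval_C]
    simp
  have hdvd := minpoly.isIntegrallyClosed_dvd (hζ.isIntegral hq0) e3
  rw [← cyclotomic_eq_minpoly hζ hq0] at hdvd
  -- Setting `ζ` to `1` is the reduction: the cyclotomic polynomial of order `p ^ (l + 1)` takes the
  -- value `p` there.
  have hev := eval_dvd (x := (1 : ℤ)) hdvd
  have : Fact p.Prime := ⟨hp⟩
  rw [eval_one_cyclotomic_prime_pow] at hev
  have e4 : eval 1 P = intWalsh d y := by simp [hP, eval_finsetSum, intWalsh]
  have e5 : eval 1 P' = intWalsh d y := by simp [hP', eval_finsetSum, intWalsh]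
  simpa [e4, e5, pow_two] using hev

/-- If `2` is not a square modulo `p`, there is no generalized bent function of order
`2 * p ^ (l + 1)` in an odd number of variables. -/
lemma not_existsGBF_of_mod_eight {p l n : ℕ} (hn : Odd n) (hp : p.Prime) (hp2 : p ≠ 2)
    (h8 : p ≡ 3 [MOD 8] ∨ p ≡ 5 [MOD 8]) : ¬ ExistsGBF (2 * p ^ (l + 1)) n := by
  intro h
  obtain ⟨d, -, hW⟩ := h.exists_intWalsh hp hp2
  have hF : Fact p.Prime := ⟨hp⟩
  have h0 := hW 0
  rw [← ZMod.intCast_zmod_eq_zero_iff_dvd] at h0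
  push_cast at h0
  obtain ⟨k, hk⟩ := hn
  have h2 : (2 : ZMod p) ≠ 0 := by
    intro h
    have : ((2 : ℕ) : ZMod p) = 0 := by exact_mod_cast h
    rw [ZMod.natCast_eq_zero_iff] at this
    exact hp2 ((Nat.prime_dvd_prime_iff_eq hp Nat.prime_two).mp this)
  have hsq : IsSquare (2 : ZMod p) := by
    refine ⟨(intWalsh d 0 : ZMod p) / 2 ^ k, ?_⟩
    rw [div_mul_div_comm, eq_div_iff (mul_ne_zero (pow_ne_zero _ h2) (pow_ne_zero _ h2))]
    have hpow : (2 : ZMod p) ^ n = 2 * (2 ^ k * 2 ^ k) := by rw [hk]; ring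
    rw [hpow] at h0
    linear_combination -h0
  rw [ZMod.exists_sq_eq_two_iff hp2] at hsq
  rcases h8 with h8 | h8 <;> · unfold Nat.ModEq at h8; omega

/-! ### Integers with squares congruent to `2 ^ (2k+1)` and with that mean square. -/

lemma int_sq_ne_two_pow_odd (u : ℤ) (k : ℕ) : u ^ 2 ≠ 2 ^ (2 * k + 1) := by
  intro h
  have h1 : u.natAbs ^ 2 = 2 ^ (2 * k + 1) := by
    zify
    rw [sq_abs]; exact h
  have h2 := congrArg (fun x => x.factorization 2) h1
  simp only [Nat.factorization_pow, Finsupp.smul_apply, smul_eq_mul,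
    Nat.prime_two.factorization_self] at h2
  omega

/-- Values `u y` whose squares are congruent to `Q = 2 ^ (2k+1)` modulo `p` and equal to `Q` on
average do not exist if `p > Q`. -/
lemma false_of_sq_modEq_of_lt {V : Type*} [Fintype V] [Nonempty V] {p k : ℕ} (u : V → ℤ)
    (hu : ∀ y, (p : ℤ) ∣ u y ^ 2 - 2 ^ (2 * k + 1))
    (hsum : ∑ y, u y ^ 2 = Fintype.card V * 2 ^ (2 * k + 1)) (hlt : 2 ^ (2 * k + 1) < p) :
    False := by
  choose T hT using hu
  have hp : (0 : ℤ) < p := by exact_mod_cast (Nat.zero_le _).trans_lt hlt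
  have hlt' : (2 : ℤ) ^ (2 * k + 1) < p := by exact_mod_cast hlt
  have hT0 : ∀ y, 0 ≤ T y := by
    intro y
    by_contra hneg
    have := hT y
    nlinarith [sq_nonneg (u y)]
  have hs : ∑ y, T y = 0 := by
    have h1 : ∑ y, (u y ^ 2 - 2 ^ (2 * k + 1)) = p * ∑ y, T y := by
      rw [Finset.mul_sum]; exact Finset.sum_congr rfl fun y _ => hT y
    rw [Finset.sum_sub_distrib, hsum] at h1
    simp only [Finset.sum_const, Finset.card_univ, nsmul_eq_mul, sub_self] at h1
    exact (mul_eq_zero.mp h1.symm).resolve_left hp.ne'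
  obtain ⟨y⟩ := ‹Nonempty V›
  have hy := (Finset.sum_eq_zero_iff_of_nonneg fun y _ => hT0 y).mp hs y (Finset.mem_univ y)
  have := hT y
  rw [hy, mul_zero, sub_eq_zero] at this
  exact int_sq_ne_two_pow_odd _ _ this

/-- Since `p` is prime and `u`, `v` are odd, `|u| = 2 * p * e ∓ v`, so `S = e * (p * e ∓ v)`. The
listed values are those with `e ≤ 1`; for `e ≥ 2`, the bounds `3 ≤ v` and `v² < p` make `S` exceed
`p + v²`. -/
lemma exists_eq_sq_add_four_mul {p u v : ℤ} (hp : Prime p) (hodd : Odd p) (hv : 3 ≤ v)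
    (hvodd : Odd v) (hvp : v ^ 2 < p) (hu : Odd u) (hd : p ∣ u ^ 2 - v ^ 2) :
    ∃ S : ℤ, 0 ≤ S ∧ u ^ 2 = v ^ 2 + 4 * p * S ∧
      (S = 0 ∨ S = p - v ∨ S = p + v ∨ p + v ^ 2 < S) := by
  have hvp' : v < p := by nlinarith
  rw [← sq_abs u] at hd ⊢
  have hu' : Odd |u| := odd_abs.mpr hu
  have hu0 : 0 ≤ |u| := abs_nonneg u
  generalize |u| = a at hd hu' hu0
  rw [sq_sub_sq] at hd
  have hcop : IsCoprime (2 : ℤ) p := by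
    obtain ⟨c, hc⟩ := hodd
    exact ⟨-c, 1, by rw [hc]; ring⟩
  rcases hp.dvd_mul.mp hd with h | h
  · have h2 : 2 ∣ a + v := (hu'.add_odd hvodd).two_dvd
    obtain ⟨e, he⟩ := hcop.mul_dvd h2 h
    have ha : a = 2 * p * e - v := by linarith
    have he1 : 1 ≤ e := by
      by_contra hcon
      have : e ≤ 0 := by omega
      nlinarith
    refine ⟨e * (p * e - v), ?_, by rw [ha]; ring, ?_⟩
    · have : 0 ≤ p * e - v := by nlinarith
      positivity
    · by_cases h1 : e = 1
      · subst h1; right; left; ring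
      · right; right; right
        have h2 : 2 ≤ e := by omega
        have h3 : 2 * p - v ≤ p * e - v := by nlinarith
        nlinarith
  · have h2 : 2 ∣ a - v := (hu'.sub_odd hvodd).two_dvd
    obtain ⟨e, he⟩ := hcop.mul_dvd h2 h
    have ha : a = 2 * p * e + v := by linarith
    have he0 : 0 ≤ e := by
      by_contra hcon
      have : e ≤ -1 := by omega
      nlinarith
    have hp0 : 0 < p := by linarith
    refine ⟨e * (p * e + v), by positivity, by rw [ha]; ring, ?_⟩
    rcases (by omega : e = 0 ∨ e = 1 ∨ 2 ≤ e) with h1 | h1 | h1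
    · subst h1; left; ring
    · subst h1; right; right; left; ring
    · right; right; right
      have h3 : 2 * p + v ≤ p * e + v := by nlinarith
      nlinarith

/-- Write `Q = 2 ^ (2k+1)` and `u² = Q + p * T`, with `T ≥ -1` of mean `0`. If the `u y` are even,
so is `T`, hence `T = 0` and `Q` is a square. If they are odd, some `T` is `-1` and `Q - p = v²`,
where `v = 1` would make `p` a Mersenne prime. For `v ≥ 3`, the excesses `u² - v²` take too few
values to have the prescribed sum. -/
lemma false_of_sq_modEq_of_lt_two_mul {V : Type*} [Fintype V] [Nonempty V] {p k : ℕ}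
    (hp : p.Prime) (hp2 : p ≠ 2) (hM : ¬ ∃ k : ℕ, p = mersenne k) (u : V → ℤ)
    (hu : ∀ y, (p : ℤ) ∣ u y ^ 2 - 2 ^ (2 * k + 1))
    (hpar : ∀ y y', (2 : ℤ) ∣ u y - u y')
    (hcard : (Fintype.card V : ℤ) = 4 * 2 ^ (2 * k + 1))
    (hsum : ∑ y, u y ^ 2 = Fintype.card V * 2 ^ (2 * k + 1)) (hlt : 2 ^ (2 * k + 1) < 2 * p) :
    False := by
  rcases lt_trichotomy (2 ^ (2 * k + 1)) p with hlt1 | heq | hgt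
  · exact false_of_sq_modEq_of_lt u hu hsum hlt1
  · exact hp2 ((Nat.prime_dvd_prime_iff_eq Nat.prime_two hp).mp
      (heq ▸ dvd_pow_self 2 (by omega))).symm
  have hpodd : Odd (p : ℤ) := by exact_mod_cast hp.odd_of_ne_two hp2
  have hpp : Prime (p : ℤ) := Nat.prime_iff_prime_int.mp hp
  have hp0 : (0 : ℤ) < p := by exact_mod_cast hp.pos
  have hlt' : (2 : ℤ) ^ (2 * k + 1) < 2 * p := by exact_mod_cast hlt
  have hgt' : (p : ℤ) < 2 ^ (2 * k + 1) := by exact_mod_cast hgt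
  have hQeven : Even ((2 : ℤ) ^ (2 * k + 1)) := even_two.pow_of_ne_zero (by omega)
  have hMQ : (2 : ℤ) ^ (2 * k + 1) ≠ p + 1 := by
    intro h
    refine hM ⟨2 * k + 1, ?_⟩
    have : 2 ^ (2 * k + 1) = p + 1 := by exact_mod_cast h
    rw [mersenne, this]; rfl
  have hnsq := fun a => int_sq_ne_two_pow_odd a k
  generalize (2 : ℤ) ^ (2 * k + 1) = Q at *
  have hu' := hu
  choose T hT using hu
  have hs : ∑ y, T y = 0 := by
    have h1 : ∑ y, (u y ^ 2 - Q) = p * ∑ y, T y := by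
      rw [Finset.mul_sum]; exact Finset.sum_congr rfl fun y _ => hT y
    rw [Finset.sum_sub_distrib, hsum] at h1
    simp only [Finset.sum_const, Finset.card_univ, nsmul_eq_mul, sub_self] at h1
    exact (mul_eq_zero.mp h1.symm).resolve_left hp0.ne'
  have hT1 : ∀ y, -1 ≤ T y := by
    intro y
    by_contra hneg
    have h1 : T y ≤ -2 := by omega
    have := hT y
    nlinarith [sq_nonneg (u y)]
  have hTpar : ∀ y, Even (T y) ↔ Even (u y) := by
    intro y
    have h1 : Even (u y ^ 2 - Q) ↔ Even (p * T y) := by rw [hT]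
    rw [Int.even_sub, Int.even_mul, Int.even_pow' two_ne_zero] at h1
    have h2 : ¬ Even (p : ℤ) := Int.not_even_iff_odd.mpr hpodd
    tauto
  obtain ⟨y₀⟩ := ‹Nonempty V›
  rcases Int.even_or_odd (u y₀) with hev | hod
  · have hT0 : ∀ y, 0 ≤ T y := by
      intro y
      have h1 : Even (T y) := by
        rw [hTpar]
        obtain ⟨a, ha⟩ := hpar y y₀
        obtain ⟨b, hb⟩ := hev
        exact ⟨a + b, by linarith⟩
      have h2 := hT1 y
      obtain ⟨b, hb⟩ := h1
      omega
    have hy := (Finset.sum_eq_zero_iff_of_nonneg fun y _ => hT0 y).mp hs y₀ (Finset.mem_univ _)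
    have := hT y₀
    rw [hy, mul_zero, sub_eq_zero] at this
    exact hnsq _ this
  · have huodd : ∀ y, Odd (u y) := by
      intro y
      obtain ⟨a, ha⟩ := hpar y y₀
      obtain ⟨b, hb⟩ := hod
      exact ⟨a + b, by linarith⟩
    have hTodd : ∀ y, Odd (T y) := fun y => by
      rw [← Int.not_even_iff_odd, hTpar, Int.not_even_iff_odd]; exact huodd y
    have hex : ∃ y, T y = -1 := by
      by_contra hcon
      push Not at hcon
      have : 0 < ∑ y, T y := Finset.sum_pos (fun y _ => by
        have h1 := hT1 y
        have h2 := hcon y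
        obtain ⟨b, hb⟩ := hTodd y
        omega) ⟨y₀, Finset.mem_univ _⟩
      omega
    obtain ⟨y₁, hy₁⟩ := hex
    obtain ⟨v, hv⟩ : ∃ v, v = |u y₁| := ⟨_, rfl⟩
    have hvodd : Odd v := by rw [hv]; exact odd_abs.mpr (huodd y₁)
    have hv2 : v ^ 2 = Q - p := by
      have := hT y₁
      rw [hy₁] at this
      rw [hv, sq_abs]; linarith
    have hv3 : 3 ≤ v := by
      have h0 : 0 ≤ v := hv ▸ abs_nonneg _
      have h1 : v ≠ 1 := by
        rintro rfl
        apply hMQ; linarith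
      obtain ⟨b, hb⟩ := hvodd
      omega
    have hvp : v ^ 2 < p := by linarith
    choose S hS0 hS hScases using fun y => exists_eq_sq_add_four_mul hpp hpodd hv3 hvodd hvp
      (huodd y) (by
        have := dvd_add (hu' y) (dvd_refl (p : ℤ))
        rwa [show u y ^ 2 - Q + p = u y ^ 2 - v ^ 2 by rw [hv2]; ring] at this)
    -- The mean of `u² - v²` is `Q - v² = p`; as there are `4 * Q` points, the `S y` add up to `Q =
    -- p + v²`.
    have hSsum : ∑ y, S y = p + v ^ 2 := by
      have h1 : ∑ y, u y ^ 2 = Fintype.card V * v ^ 2 + 4 * p * ∑ y, S y := by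
        simp only [hS, Finset.sum_add_distrib, ← Finset.mul_sum]
        simp [Finset.card_univ]
      rw [hsum, hcard] at h1
      have h2 : 4 * p * (∑ y, S y - Q) = 0 := by rw [hv2] at h1; linear_combination -h1
      have h3 := (mul_eq_zero.mp h2).resolve_left (by positivity)
      linarith
    have hSle : ∀ y, S y ≤ p + v ^ 2 := by
      intro y
      rw [← hSsum]
      exact Finset.single_le_sum (fun y _ => hS0 y) (Finset.mem_univ y)
    have hdec : ∀ y, S y = (if S y = p - v then (p - v : ℤ) else 0)
        + (if S y = p + v then (p + v : ℤ) else 0) := by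
      intro y
      have h1 := hSle y
      have h2 := hScases y
      split_ifs <;> omega
    have hAB : ((Finset.univ.filter fun y => S y = p - v).card : ℤ) * (p - v)
        + ((Finset.univ.filter fun y => S y = p + v).card : ℤ) * (p + v) = p + v ^ 2 := by
      rw [← hSsum, Finset.sum_congr rfl fun y _ => hdec y, Finset.sum_add_distrib,
        ← Finset.sum_filter, ← Finset.sum_filter]
      simp only [Finset.sum_const, nsmul_eq_mul]
    generalize (Finset.univ.filter fun y => S y = p - v).card = A at hAB
    generalize (Finset.univ.filter fun y => S y = p + v).card = B at hAB
    have hle : (A : ℤ) + B ≤ 2 := by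
      by_contra hcon
      have h3 : 3 ≤ (A : ℤ) + B := by omega
      have h4 : (0 : ℤ) < p - v := by nlinarith
      have h5 : (B : ℤ) * (p - v) ≤ B * (p + v) :=
        mul_le_mul_of_nonneg_left (by linarith) (by positivity)
      have h6 : 3 * (p - v : ℤ) ≤ (A + B) * (p - v) := mul_le_mul_of_nonneg_right h3 h4.le
      nlinarith
    have hA : A ≤ 2 := by omega
    have hB : B ≤ 2 := by omega
    -- This is the case `A = 2`, `B = 0` of `hAB`; the other cases contradict `3 ≤ v` or `v² < p`.
    have hprod : (p : ℤ) ≠ v * (v + 2) := by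
      intro h
      rcases hpp.irreducible.isUnit_or_isUnit h with h1 | h1 <;>
        · rw [Int.isUnit_iff] at h1; omega
    interval_cases A <;> interval_cases B <;> push_cast at hAB hle <;> first
      | omega
      | nlinarith
      | exact hprod (by linarith)

/-! ### Nonexistence for one odd prime. -/

/-- The integral data attached to a generalized bent function of order `2 * p ^ (l + 1)` in `n`
variables, where `n = 2 * k + 3`. -/
lemma ExistsGBF.exists_half_walsh {p l k : ℕ} (hp : p.Prime) (hp2 : p ≠ 2)
    (h : ExistsGBF (2 * p ^ (l + 1)) (2 * k + 3)) :
    ∃ u : (Fin (2 * k + 3) → ZMod 2) → ℤ, (∀ y, (p : ℤ) ∣ u y ^ 2 - 2 ^ (2 * k + 1)) ∧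
      (∀ y y', (2 : ℤ) ∣ u y - u y') ∧
      ∑ y, u y ^ 2 = Fintype.card (Fin (2 * k + 3) → ZMod 2) * 2 ^ (2 * k + 1) := by
  obtain ⟨d, hd, hW⟩ := h.exists_intWalsh hp hp2
  choose u hu using even_intWalsh (by omega) d hd
  have h4 : (2 : ℤ) ^ (2 * k + 3) = 4 * 2 ^ (2 * k + 1) := by ring
  refine ⟨u, fun y => ?_, fun y y' => ?_, ?_⟩
  · have h1 := hW y
    rw [hu, h4, show (2 * u y) ^ 2 - 4 * 2 ^ (2 * k + 1) = 2 ^ 2 * (u y ^ 2 - 2 ^ (2 * k + 1)) by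
      ring] at h1
    refine ((Nat.prime_iff_prime_int.mp hp).dvd_mul.mp h1).resolve_left fun h2 => ?_
    have h3 := (Nat.prime_iff_prime_int.mp hp).dvd_of_dvd_pow h2
    exact hp2 ((Nat.prime_dvd_prime_iff_eq hp Nat.prime_two).mp (by exact_mod_cast h3))
  · have := four_dvd_intWalsh_sub (by omega) d hd y y'
    rw [hu, hu] at this
    omega
  · have h1 := sum_intWalsh_sq d hd
    simp only [hu, mul_pow, ← Finset.mul_sum] at h1
    simp only [Fintype.card_pi, ZMod.card, Finset.prod_const, Finset.card_univ, Fintype.card_fin]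
    push_cast
    rw [h4] at h1 ⊢
    linarith

/-- Here `2^(n-2)` is not an integer, so the halved argument does not apply. Both Walsh values are
even, and nonzero because `p ∤ 2`, so their squares add up to at least `8`, against `4` from
Parseval. -/
lemma not_existsGBF_one {p l : ℕ} (hp : p.Prime) (hp2 : p ≠ 2) :
    ¬ ExistsGBF (2 * p ^ (l + 1)) 1 := by
  intro h
  obtain ⟨d, hd, hW⟩ := h.exists_intWalsh hp hp2
  have h1 := sum_intWalsh_sq d hd
  have h2 : ∀ y, 4 ≤ intWalsh d y ^ 2 := by
    intro y
    obtain ⟨c, hc⟩ := even_intWalsh one_pos d hd y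
    have hc0 : c ≠ 0 := by
      rintro rfl
      have := hW y
      rw [hc] at this
      have h3 : (p : ℤ) ∣ 2 := by simpa using this
      exact hp2 ((Nat.prime_dvd_prime_iff_eq hp Nat.prime_two).mp (by exact_mod_cast h3))
    rw [hc]
    have : 0 < c ^ 2 := by positivity
    nlinarith
  have h3 := Finset.card_nsmul_le_sum Finset.univ (fun y => intWalsh d y ^ 2) 4 fun y _ => h2 y
  rw [h1] at h3
  simp at h3

lemma not_existsGBF_of_lt_four_mul {p l n : ℕ} (hn : Odd n) (hp : p.Prime) (hp2 : p ≠ 2)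
    (hlt : 2 ^ n < 4 * p) : ¬ ExistsGBF (2 * p ^ (l + 1)) n := by
  obtain ⟨k, rfl⟩ := hn
  rcases k with _ | k
  · exact not_existsGBF_one hp hp2
  · intro h
    obtain ⟨u, hu, -, hsum⟩ := ExistsGBF.exists_half_walsh (k := k) hp hp2 h
    refine false_of_sq_modEq_of_lt u hu hsum ?_
    have : 2 ^ (2 * (k + 1) + 1) = 4 * 2 ^ (2 * k + 1) := by ring
    linarith

lemma not_existsGBF_of_lt_eight_mul {p l n : ℕ} (hn : Odd n) (hp : p.Prime) (hp2 : p ≠ 2)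
    (hM : ¬ ∃ k : ℕ, p = mersenne k) (hlt : 2 ^ n < 8 * p) :
    ¬ ExistsGBF (2 * p ^ (l + 1)) n := by
  obtain ⟨k, rfl⟩ := hn
  rcases k with _ | k
  · exact not_existsGBF_one hp hp2
  · intro h
    obtain ⟨u, hu, hpar, hsum⟩ := ExistsGBF.exists_half_walsh (k := k) hp hp2 h
    refine false_of_sq_modEq_of_lt_two_mul hp hp2 hM u hu hpar ?_ hsum ?_
    · simp only [Fintype.card_pi, ZMod.card, Finset.prod_const, Finset.card_univ, Fintype.card_fin]
      push_cast; ring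
    · have : 2 ^ (2 * (k + 1) + 1) = 4 * 2 ^ (2 * k + 1) := by ring
      linarith

/-! ### Several primes and the final assembly. -/

/-- Iterated descent along an increasing sequence of odd primes. -/
lemma ExistsGBF.of_prod_le {n s : ℕ} (hn : 0 < n) {p α : ℕ → ℕ}
    (hprime : ∀ i ∈ Finset.Icc 1 s, (p i).Prime) (hodd : ∀ i ∈ Finset.Icc 1 s, Odd (p i))
    (hmono : StrictMonoOn p (Set.Icc 1 s)) (hα : ∀ i ∈ Finset.Icc 1 s, 0 < α i) {r : ℕ}
    (hr : ∀ i ∈ Finset.Icc (r + 1) s, 2 ^ n + 2 < p i + p 1) (hrs : r ≤ s)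
    (h : ExistsGBF (2 * ∏ i ∈ Finset.Icc 1 s, p i ^ α i) n) :
    ExistsGBF (2 * ∏ i ∈ Finset.Icc 1 r, p i ^ α i) n := by
  induction s, hrs using Nat.le_induction with
  | base => exact h
  | succ t hrt ih =>
    have hsub : ∀ i, i ∈ Finset.Icc 1 t → i ∈ Finset.Icc 1 (t + 1) := fun i hi => by
      rw [Finset.mem_Icc] at hi ⊢; omega
    refine ih (fun i hi => hprime i (hsub i hi)) (fun i hi => hodd i (hsub i hi))
      (hmono.mono fun i hi => ⟨hi.1, hi.2.trans (Nat.le_succ t)⟩) (fun i hi => hα i (hsub i hi))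
      (fun i hi => hr i (by rw [Finset.mem_Icc] at hi ⊢; omega)) ?_
    have hmem : t + 1 ∈ Finset.Icc 1 (t + 1) := by simp
    have h1mem : (1 : ℕ) ∈ Set.Icc 1 (t + 1) := by simp
    rw [Finset.prod_Icc_succ_top (by omega)] at h
    obtain ⟨l, hl⟩ := Nat.exists_eq_succ_of_ne_zero (hα _ hmem).ne'
    rw [hl] at h
    have hdiv : ∀ q : ℕ, q.Prime → q ∣ ∏ i ∈ Finset.Icc 1 t, p i ^ α i →
        ∃ i ∈ Finset.Icc 1 t, q = p i := by
      intro q hq hqd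
      obtain ⟨i, hi, hqi⟩ := (hq.prime.dvd_finsetProd_iff _).mp hqd
      exact ⟨i, hi, (Nat.prime_dvd_prime_iff_eq hq (hprime i (hsub i hi))).mp
        (hq.dvd_of_dvd_pow hqi)⟩
    refine h.of_mul_prime_pow (q := p 1) hn (hprime _ hmem) ?_ ?_ ?_ ?_ ?_ ?_
    · intro h2
      have := hodd _ hmem
      rw [h2] at this
      exact absurd this (by decide)
    · exact Finset.prod_induction _ Odd (fun _ _ => Odd.mul) odd_one
        fun i hi => (hodd i (hsub i hi)).pow
    · intro hd
      obtain ⟨i, hi, hpi⟩ := hdiv _ (hprime _ hmem) hd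
      rw [Finset.mem_Icc] at hi
      have := hmono ⟨hi.1, by omega⟩ ⟨by omega, le_rfl⟩ (show i < t + 1 by omega)
      omega
    · intro q hq hqd
      obtain ⟨i, hi, rfl⟩ := hdiv q hq hqd
      rw [Finset.mem_Icc] at hi
      exact hmono.monotoneOn h1mem ⟨hi.1, by omega⟩ hi.1
    · exact hmono.monotoneOn h1mem ⟨by omega, le_rfl⟩ (by omega)
    · exact hr _ (by rw [Finset.mem_Icc]; omega)

lemma two_pow_lt_of_zpow_lt {n c p : ℕ} (h : (2 : ℝ) ^ ((n : ℤ) - c) < p) : 2 ^ n < 2 ^ c * p := by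
  rw [zpow_sub₀ two_ne_zero, zpow_natCast, zpow_natCast, div_lt_iff₀ (by positivity)] at h
  rw [mul_comm]
  exact_mod_cast h

theorem corollary3p9 (n : ℕ) (hn : Odd n) (s : ℕ) (hs : 1 ≤ s) (p α : ℕ → ℕ)
    (hprime : ∀ i ∈ Finset.Icc 1 s, (p i).Prime)
    (hodd : ∀ i ∈ Finset.Icc 1 s, Odd (p i))
    (hmono : StrictMonoOn p (Set.Icc 1 s))
    (hα : ∀ i ∈ Finset.Icc 1 s, 0 < α i)
    (m : ℕ) (hm : m = 2 * ∏ i ∈ Finset.Icc 1 s, p i ^ α i) :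
    (s = 1 →
      ((2 : ℝ) ^ ((n : ℤ) - 2) < (p 1 : ℝ) → ¬ ExistsGBF m n) ∧
      ((¬ ∃ k : ℕ, p 1 = mersenne k) → (2 : ℝ) ^ ((n : ℤ) - 3) < (p 1 : ℝ) →
        ¬ ExistsGBF m n) ∧
      (p 1 ≡ 3 [MOD 8] ∨ p 1 ≡ 5 [MOD 8] → ¬ ExistsGBF m n)) ∧
    (2 ≤ s →
      (∀ r : ℕ, IsLeast {r : ℕ | r + 1 ≤ s ∧ 2 ^ n + 2 < p (r + 1) + p 1} r →
        ¬ ExistsGBF (2 * ∏ i ∈ Finset.Icc 1 r, p i ^ α i) n → ¬ ExistsGBF m n) ∧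
      ((2 : ℝ) ^ ((n : ℤ) - 2) < (p 1 : ℝ) → 2 ^ n + 2 < p 1 + p 2 → ¬ ExistsGBF m n)) := by
  have h1 : 1 ∈ Finset.Icc 1 s := Finset.mem_Icc.mpr ⟨le_rfl, hs⟩
  have hp := hprime 1 h1
  have hp2 : p 1 ≠ 2 := by
    intro h2
    have := hodd 1 h1
    rw [h2] at this
    exact absurd this (by decide)
  obtain ⟨l, hl⟩ := Nat.exists_eq_succ_of_ne_zero (hα 1 h1).ne'
  have hprod1 : ∏ i ∈ Finset.Icc 1 1, p i ^ α i = p 1 ^ (l + 1) := by simp [hl]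
  have hdesc : ∀ r, r + 1 ≤ s → 2 ^ n + 2 < p (r + 1) + p 1 →
      ∀ i ∈ Finset.Icc (r + 1) s, 2 ^ n + 2 < p i + p 1 := by
    intro r hr hlt i hi
    rw [Finset.mem_Icc] at hi
    have := hmono.monotoneOn (show r + 1 ∈ Set.Icc 1 s from ⟨by omega, hr⟩)
      (show i ∈ Set.Icc 1 s from ⟨by omega, hi.2⟩) hi.1
    omega
  refine ⟨?_, fun h2s => ⟨?_, ?_⟩⟩
  · rintro rfl
    rw [hm, hprod1]
    refine ⟨fun h => ?_, fun hM h => ?_, not_existsGBF_of_mod_eight hn hp hp2⟩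
    · exact not_existsGBF_of_lt_four_mul hn hp hp2 (two_pow_lt_of_zpow_lt (c := 2) h)
    · exact not_existsGBF_of_lt_eight_mul hn hp hp2 hM (two_pow_lt_of_zpow_lt (c := 3) h)
  · rintro r ⟨⟨hr, hlt⟩, -⟩ hno hex
    rw [hm] at hex
    exact hno (hex.of_prod_le hn.pos hprime hodd hmono hα (hdesc r hr hlt) (by omega))
  · intro h hlt hex
    rw [hm] at hex
    -- Descending to `r = 1` needs no minimality of `r`, and leaves the one-prime case.
    have := hex.of_prod_le hn.pos hprime hodd hmono hα 
      (hdesc 1 h2s (hlt.trans_eq (add_comm _ _))) hs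
    rw [hprod1] at this
    exact not_existsGBF_of_lt_four_mul hn hp hp2 (two_pow_lt_of_zpow_lt (c := 2) h) this
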